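/- Let $1\le n\le m$ be integers, let $q$ be a prime power, and let $\mathbb F_q$ be the field with $q$ elements. A code is an $\mathbb F_q$-linear subspace $\mathcal C\subseteq\mathbb F_q^{m\times n}$, and $\mathrm{maxrk}(\mathcal C)=\max\{\mathrm{rk}(M):M\in\mathcal C\}$. A code $\mathcal A\subseteq\mathbb F_q^{m\times n}$ is an optimal anticode if $\dim\mathcal A=m\cdot\mathrm{maxrk}(\mathcal A)$. The weight of a code $\mathcal C$ is $$\mathrm{wt}(\mathcal C)=\min\{\mathrm{maxrk}(\mathcal A):\mathcal C\subseteq\mathcal A\subseteq\mathbb F_q^{m\times n},\ \mathcal A\text{ an optimal anticode}\},$$ and for $1\le r\le\dim\mathcal C$ the $r$-th generalized rank weight of $\mathcal C$ is $$d_r(\mathcal C)=\min\{\mathrm{wt}(\mathcal D):\mathcal D\subseteq\mathcal C\text{ a linear subspace with }\dim\mathcal D\ge r\}.$$ Let $d_1\le d_2\le\dots\le d_k$ be a non-decreasing sequence of positive integers. There exists a code $\mathcal C\subseteq\mathbb F_q^{m\times n}$ with $\dim\mathcal C=k$ and $d_r(\mathcal C)=d_r$ for all $1\le r\le k$ if and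 only if $k\le mn$, $d_k\le n$, and every constant subsequence of $d_1,\dots,d_k$ has length at most $m$. (For $k=0$ the sequence is empty and the condition $d_k\le n$ is void.) -/

import Mathlib

/-! Rank-metric codes in the space of `m × n` matrices over a field `F`, in the convention `n ≤ m`
(at least as many rows as columns). A code is an `F`-linear subspace. -/

namespace RankMetric

variable {F : Type*} [Field F] {m n : ℕ}

/-- The maximum rank of the matrices in the code `C`. -/
noncomputable def maxRank (C : Submodule F (Matrix (Fin m) (Fin n) F)) : ℕ :=
  sSup {r : ℕ | ∃ M ∈ C, M.rank = r}

/-- An optimal anticode is a code attaining the bound `dim A ≤ m * maxRank A`. -/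
def IsOptimalAnticode (A : Submodule F (Matrix (Fin m) (Fin n) F)) : Prop :=
  Module.finrank F A = m * maxRank A

/-- The weight of a code: the least maximum rank of an optimal anticode containing it. -/
noncomputable def weight (C : Submodule F (Matrix (Fin m) (Fin n) F)) : ℕ :=
  sInf {w : ℕ | ∃ A : Submodule F (Matrix (Fin m) (Fin n) F),
    C ≤ A ∧ IsOptimalAnticode A ∧ maxRank A = w}

/-- The `r`-th generalized rank weight of a code, meaningful for `1 ≤ r ≤ dim C`: the least weight
of a subcode of dimension at least `r`. -/
noncomputable def genWeight (C : Submodule F (Matrix (Fin m) (Fin n) F)) (r : ℕ) : ℕ :=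
  sInf {w : ℕ | ∃ D : Submodule F (Matrix (Fin m) (Fin n) F),
    D ≤ C ∧ r ≤ Module.finrank F D ∧ weight D = w}

/-- The finite sequence `d` (indexed from `0`) is the sequence of all generalized rank weights
`d_1(C), …, d_k(C)` of the code `C`, where `k = dim C`. -/
def IsGenWeightSequence (C : Submodule F (Matrix (Fin m) (Fin n) F)) {k : ℕ}
    (d : Fin k → ℕ) : Prop :=
  Module.finrank F C = k ∧ ∀ i : Fin k, genWeight C ((i : ℕ) + 1) = d i

/-- The supremum defining `maxRank` is a maximum. -/
theorem isGreatest_maxRank (C : Submodule F (Matrix (Fin m) (Fin n) F)) :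
    IsGreatest {r : ℕ | ∃ M ∈ C, M.rank = r} (maxRank C) := by
  have hb : BddAbove {r : ℕ | ∃ M ∈ C, M.rank = r} := by
    refine ⟨n, ?_⟩
    rintro r ⟨M, -, rfl⟩
    exact M.rank_le_width
  exact ⟨Nat.sSup_mem ⟨_, 0, C.zero_mem, rfl⟩ hb, fun r hr => le_csSup hb hr⟩

/-- The whole space has maximum rank `n`, when `n ≤ m`. -/
theorem maxRank_top (h : n ≤ m) :
    maxRank (⊤ : Submodule F (Matrix (Fin m) (Fin n) F)) = n := by
  refine (isGreatest_maxRank _).unique ⟨?_, ?_⟩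
  · refine ⟨Matrix.of fun i j => if i = Fin.castLE h j then 1 else 0, trivial, ?_⟩
    apply le_antisymm (Matrix.rank_le_width _)
    have hs : (Matrix.of fun (i : Fin m) (j : Fin n) =>
        if i = Fin.castLE h j then (1 : F) else 0).submatrix (Fin.castLE h) id = 1 := by
      ext i j
      simp [Matrix.one_apply, (Fin.castLE_injective h).eq_iff]
    have := Matrix.rank_submatrix_le (Matrix.of fun (i : Fin m) (j : Fin n) =>
        if i = Fin.castLE h j then (1 : F) else 0) (Fin.castLE h) id
    rw [hs, Matrix.rank_one, Fintype.card_fin] at this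
    exact this
  · rintro r ⟨M, -, rfl⟩
    exact M.rank_le_width

/-- The whole space is an optimal anticode, so every code has a weight, when `n ≤ m`. -/
theorem isOptimalAnticode_top (h : n ≤ m) :
    IsOptimalAnticode (⊤ : Submodule F (Matrix (Fin m) (Fin n) F)) := by
  simp [IsOptimalAnticode, maxRank_top h, Module.finrank_matrix]

/-- The infimum defining `weight` is a minimum, when `n ≤ m`. -/
theorem isLeast_weight (h : n ≤ m) (C : Submodule F (Matrix (Fin m) (Fin n) F)) :
    IsLeast {w : ℕ | ∃ A : Submodule F (Matrix (Fin m) (Fin n) F),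
      C ≤ A ∧ IsOptimalAnticode A ∧ maxRank A = w} (weight C) :=
  ⟨Nat.sInf_mem ⟨_, ⊤, le_top, isOptimalAnticode_top h, rfl⟩, fun _ hw => Nat.sInf_le hw⟩

/-- The infimum defining `genWeight` is a minimum, for `r ≤ dim C`. -/
theorem isLeast_genWeight (C : Submodule F (Matrix (Fin m) (Fin n) F)) {r : ℕ}
    (hr : r ≤ Module.finrank F C) :
    IsLeast {w : ℕ | ∃ D : Submodule F (Matrix (Fin m) (Fin n) F),
      D ≤ C ∧ r ≤ Module.finrank F D ∧ weight D = w} (genWeight C r) :=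
  ⟨Nat.sInf_mem ⟨_, C, le_rfl, hr, rfl⟩, fun _ hw => Nat.sInf_le hw⟩

end RankMetric

/-! A Gabidulin code, formed by the linearized polynomials with `s` coefficients over the extension
of degree `m`, has dimension `m * s`, and its nonzero members have rank greater than `n - s`. Such a
code meets an anticode of maximum rank `n - s` trivially, which bounds the dimension of an
anticode by `m` times its maximum rank.

Necessity: every optimal anticode of maximum rank `w < n` lies in one of maximum rank `w + 1`, by
induction on `n` through restriction to hyperplanes. By duality for the trace product, every optimal
anticode of maximum rank `w + 1` contains one of maximum rank `w`. Cutting a subcode down to it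
costs at most `m` dimensions, so `d_r < d_(r+m)`.

Sufficiency: choose `g_j` in the Gabidulin code with `n - j` coefficients vanishing on the last
`n - j - 1` vectors of a basis, and let `β` run over a basis of the extension. The maps `β • g_j`
with `j < w` span an optimal anticode of maximum rank `w`, whereas the nonzero combinations of those
with `j ≥ w` have rank greater than `w`. The code is spanned by one map with index `j = d_i - 1` for
each `i`, with distinct `β` for equal `d_i`. -/

open Module

namespace RankMetric

section LinearizedPolynomial

open Polynomial in
/-- The linearized polynomial over `L` with the coefficients `a`, which induces the map
`∑ i, a i • frobComp α i` on the points of `α`. -/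
noncomputable def linearizedPoly (F : Type*) {L : Type*} [Fintype F] [Field L] {s : ℕ}
    (a : Fin s → L) : L[X] :=
  ∑ i, C (a i) * X ^ (Fintype.card F ^ (i : ℕ))

variable {F L : Type*} [Field F] [Fintype F] [Field L] {s : ℕ} {a : Fin s → L}

theorem linearizedPoly_ne_zero (ha : a ≠ 0) :
    linearizedPoly F a ≠ 0 := by
  obtain ⟨i, hi⟩ := Function.ne_iff.1 ha
  refine fun h => hi ?_
  have hcoeff : (linearizedPoly F a).coeff (Fintype.card F ^ (i : ℕ)) = a i := by
    rw [linearizedPoly, Polynomial.finsetSum_coeff, Finset.sum_eq_single i]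
    · simp only [Polynomial.coeff_C_mul, Polynomial.coeff_X_pow_self, mul_one]
    · intro j _ hj
      rw [Polynomial.coeff_C_mul_X_pow, if_neg]
      exact fun h => hj (Fin.ext (Nat.pow_right_injective Fintype.one_lt_card h).symm)
    · exact fun h => absurd (Finset.mem_univ i) h
  rw [← hcoeff, h, Polynomial.coeff_zero, Pi.zero_apply]

theorem natDegree_linearizedPoly_le :
    (linearizedPoly F a).natDegree ≤ Fintype.card F ^ (s - 1) := by
  refine Polynomial.natDegree_sum_le_of_forall_le _ _ fun i _ => ?_
  exact (Polynomial.natDegree_C_mul_X_pow_le _ _).trans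
    (Nat.pow_le_pow_right Fintype.card_pos (by omega))

end LinearizedPolynomial

section Gabidulin

variable {F L V : Type*} [Field F] [Fintype F] [Field L] [Algebra F L] [AddCommGroup V] [Module F V]

/-- The composite of `α` with the `i`-th power of the relative Frobenius map of `L` over `F`. -/
noncomputable def frobComp (α : V →ₗ[F] L) (i : ℕ) : V →ₗ[F] L :=
  ((FiniteField.frobeniusAlgHom F L) ^ i).toLinearMap ∘ₗ α

theorem frobComp_apply (α : V →ₗ[F] L) (i : ℕ) (x : V) :
    frobComp α i x = α x ^ (Fintype.card F ^ i) := by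
  simp only [frobComp, LinearMap.comp_apply, AlgHom.toLinearMap_apply, AlgHom.coe_pow,
    FiniteField.coe_frobeniusAlgHom, pow_iterate]

theorem eval_linearizedPoly {s : ℕ} (a : Fin s → L) (α : V →ₗ[F] L) (x : V) :
    (linearizedPoly F a).eval (α x) = (∑ i, a i • frobComp α i) x := by
  simp only [linearizedPoly, Polynomial.eval_finsetSum, Polynomial.eval_mul, Polynomial.eval_C,
    Polynomial.eval_pow, Polynomial.eval_X, LinearMap.sum_apply, LinearMap.smul_apply,
    frobComp_apply, smul_eq_mul]

/-- The Gabidulin code of the linearized polynomials with `s` coefficients, evaluated along `α`. -/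
noncomputable def gabidulin (α : V →ₗ[F] L) (s : ℕ) : Submodule L (V →ₗ[F] L) :=
  Submodule.span L (Set.range fun i : Fin s => frobComp α i)

theorem gabidulin_mono (α : V →ₗ[F] L) {s t : ℕ} (h : s ≤ t) : gabidulin α s ≤ gabidulin α t := by
  refine Submodule.span_mono ?_
  rintro _ ⟨i, rfl⟩
  exact ⟨Fin.castLE h i, rfl⟩

variable [FiniteDimensional F V] {α : V →ₗ[F] L} (hα : Function.Injective α) {s : ℕ}

include hα

/-- The kernel consists of roots of the linearized polynomial, whose degree is less
than `card F ^ s`. -/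
theorem finrank_ker_sum_frobComp_lt {a : Fin s → L} (ha : a ≠ 0) :
    finrank F (LinearMap.ker (∑ i, a i • frobComp α i)) < s := by
  classical
  set K := LinearMap.ker (∑ i, a i • frobComp α i)
  have : Finite K := Module.finite_of_finite F
  have := Fintype.ofFinite K
  have hroots : (Finset.univ.image (α ∘ ((↑) : K → V))).card ≤ (linearizedPoly F a).natDegree := by
    refine Polynomial.card_le_degree_of_subset_roots fun y hy => ?_
    obtain ⟨x, -, rfl⟩ := Finset.mem_image.1 hy
    rw [Polynomial.mem_roots (linearizedPoly_ne_zero ha), Polynomial.IsRoot.def,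
      Function.comp_apply, eval_linearizedPoly, LinearMap.mem_ker.1 x.2]
  rw [Finset.card_image_of_injective _ (hα.comp Subtype.val_injective), Finset.card_univ,
    Module.card_eq_pow_finrank (K := F)] at hroots
  have hle := (Nat.pow_le_pow_iff_right Fintype.one_lt_card).1
    (hroots.trans natDegree_linearizedPoly_le)
  obtain ⟨i, -⟩ := Function.ne_iff.1 ha
  have := i.2
  omega

theorem finrank_ker_lt_of_mem_gabidulin {f : V →ₗ[F] L} (hf : f ∈ gabidulin α s) (h0 : f ≠ 0) :
    finrank F (LinearMap.ker f) < s := by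
  obtain ⟨a, rfl⟩ := (Submodule.mem_span_range_iff_exists_fun L).1 hf
  refine finrank_ker_sum_frobComp_lt hα ?_
  rintro rfl
  simp only [Pi.zero_apply, zero_smul, Finset.sum_const_zero, ne_eq, not_true_eq_false] at h0

theorem finrank_gabidulin (hs : s ≤ finrank F V) : finrank L (gabidulin α s) = s := by
  rw [gabidulin, finrank_span_eq_card, Fintype.card_fin]
  rw [Fintype.linearIndependent_iff]
  intro a ha
  by_contra! h
  have := finrank_ker_sum_frobComp_lt hα (a := a) (Function.ne_iff.2 h)
  rw [ha, LinearMap.ker_zero, finrank_top] at this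
  omega

theorem finrank_restrictScalars_gabidulin [FiniteDimensional F L] (hs : s ≤ finrank F V) :
    finrank F ((gabidulin α s).restrictScalars F) = finrank F L * s := by
  have : Module.Free L (gabidulin α s) := Module.Free.of_divisionRing L (gabidulin α s)
  exact (Module.finrank_mul_finrank F L (gabidulin α s)).symm.trans
    (by rw [finrank_gabidulin hα hs])

theorem exists_mem_gabidulin_ker_eq (K : Submodule F V) :
    ∃ f ∈ gabidulin α (finrank F K + 1), LinearMap.ker f = K := by
  let b := finBasis F K
  let ev : (Fin (finrank F K + 1) → L) →ₗ[L] Fin (finrank F K) → L :=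
    Matrix.mulVecLin (.of fun j i => frobComp α i (b j))
  obtain ⟨a, ha, ha0⟩ := Submodule.exists_mem_ne_zero_of_ne_bot
    (ev.ker_ne_bot_of_finrank_lt (by rw [finrank_fin_fun, finrank_fin_fun]; omega))
  have hle : K ≤ LinearMap.ker (∑ i, a i • frobComp α i) := by
    have h : (∑ i, a i • frobComp α i) ∘ₗ K.subtype = 0 := b.ext fun j => by
      simpa [ev, Matrix.mulVec, dotProduct, mul_comm] using congr_fun ha j
    exact fun x hx => LinearMap.congr_fun h ⟨x, hx⟩
  refine ⟨_, (Submodule.mem_span_range_iff_exists_fun L).2 ⟨a, rfl⟩, ?_⟩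
  exact (Submodule.eq_of_le_of_finrank_le hle
    (Nat.lt_succ_iff.1 (finrank_ker_sum_frobComp_lt hα ha0))).symm

end Gabidulin

theorem exists_extension_finrank_eq (F : Type*) [Field F] [Finite F] {m : ℕ} (hm : 0 < m) :
    ∃ (L : Type) (_ : Field L) (_ : Algebra F L), FiniteDimensional F L ∧ finrank F L = m := by
  obtain ⟨p, hp⟩ := CharP.exists F
  have : Fact p.Prime := ⟨CharP.char_is_prime F p⟩
  have : NeZero m := ⟨hm.ne'⟩
  exact ⟨FiniteField.Extension F p m, inferInstance, inferInstance, inferInstance,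
    FiniteField.finrank_extension F p m⟩

theorem exists_linearEquiv_comp_eq_of_ker_eq {F V W W' : Type*} [Field F]
    [AddCommGroup V] [Module F V] [AddCommGroup W] [Module F W] [AddCommGroup W'] [Module F W']
    [FiniteDimensional F W] [FiniteDimensional F W'] (hW : finrank F W = finrank F W')
    {f : V →ₗ[F] W} {g : V →ₗ[F] W'} (h : LinearMap.ker f = LinearMap.ker g) :
    ∃ e : W ≃ₗ[F] W', e ∘ₗ f = g := by
  obtain ⟨e₀⟩ := FiniteDimensional.nonempty_linearEquiv_of_finrank_eq hW
  let r : LinearMap.range f ≃ₗ[F] LinearMap.range g :=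
    f.quotKerEquivRange.symm ≪≫ₗ Submodule.quotEquivOfEq _ _ h ≪≫ₗ g.quotKerEquivRange
  have hr (x : V) : r ⟨f x, x, rfl⟩ = ⟨g x, x, rfl⟩ :=
    congrArg (fun y => g.quotKerEquivRange (Submodule.quotEquivOfEq _ _ h y))
      (f.quotKerEquivRange.symm_apply_eq.2 rfl : _ = Submodule.Quotient.mk x)
  obtain ⟨e₁, he₁⟩ := Submodule.exists_linearEquiv_restrict_eq
    (r ≪≫ₗ e₀.symm.submoduleMap (LinearMap.range g))
  refine ⟨e₁ ≪≫ₗ e₀, LinearMap.ext fun x => ?_⟩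
  have hx : e₀.symm (g x) = e₁ (f x) := by
    rw [← he₁ ⟨f x, x, rfl⟩, LinearEquiv.trans_apply, hr]
    rfl
  exact (e₀.symm_apply_eq.1 hx).symm

section Anticode

variable {F V W : Type*} [Field F] [AddCommGroup V] [Module F V] [AddCommGroup W] [Module F W]

/-- An anticode of linear maps: all its members have rank at most `w`. -/
def IsAnticode (A : Submodule F (V →ₗ[F] W)) (w : ℕ) : Prop :=
  ∀ f ∈ A, finrank F (LinearMap.range f) ≤ w

variable {A B : Submodule F (V →ₗ[F] W)} {w : ℕ} [FiniteDimensional F V]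

theorem IsAnticode.sup {w' : ℕ} (hA : IsAnticode A w) (hB : IsAnticode B w') :
    IsAnticode (A ⊔ B) (w + w') := by
  intro _ h
  obtain ⟨f, hf, g, hg, rfl⟩ := Submodule.mem_sup.1 h
  calc finrank F (LinearMap.range (f + g))
      ≤ finrank F (LinearMap.range f ⊔ LinearMap.range g : Submodule F W) :=
        Submodule.finrank_mono (LinearMap.range_add_le f g)
    _ ≤ finrank F (LinearMap.range f) + finrank F (LinearMap.range g) :=
        Submodule.finrank_add_le_finrank_add_finrank _ _
    _ ≤ w + w' := add_le_add (hA f hf) (hB g hg)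

variable [FiniteDimensional F W] [Finite F] (hVW : finrank F V ≤ finrank F W)

include hVW

theorem exists_mrd_mem {s : ℕ}
    (hs : s ≤ finrank F V) {f : V →ₗ[F] W} (hf : finrank F (LinearMap.ker f) < s) :
    ∃ H : Submodule F (V →ₗ[F] W), f ∈ H ∧ finrank F H = finrank F W * s ∧
      ∀ g ∈ H, g ≠ 0 → finrank F (LinearMap.ker g) < s := by
  have := Fintype.ofFinite F
  obtain ⟨L, _, _, _, hL⟩ := exists_extension_finrank_eq F (m := finrank F W) (by omega)
  obtain ⟨α, hα⟩ := finrank_le_iff_exists_linearMap.1 (hVW.trans hL.ge)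
  obtain ⟨g, hg, hgf⟩ := exists_mem_gabidulin_ker_eq hα (LinearMap.ker f)
  obtain ⟨e, he⟩ := exists_linearEquiv_comp_eq_of_ker_eq hL hgf
  let E : (V →ₗ[F] L) ≃ₗ[F] (V →ₗ[F] W) := LinearEquiv.congrRight e
  refine ⟨((gabidulin α s).restrictScalars F).map E.toLinearMap,
    ⟨g, gabidulin_mono α hf hg, he⟩, ?_, ?_⟩
  · rw [LinearEquiv.finrank_map_eq, finrank_restrictScalars_gabidulin hα hs, hL]
  · rintro _ ⟨h, hh, rfl⟩ h0
    have hker : LinearMap.ker (E h) = LinearMap.ker h := LinearEquiv.ker_comp e h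
    change finrank F (LinearMap.ker (E h)) < s
    rw [hker]
    exact finrank_ker_lt_of_mem_gabidulin hα hh fun h' => h0 (by rw [h', map_zero])

theorem IsAnticode.finrank_le (hA : IsAnticode A w) :
    finrank F A ≤ finrank F W * w := by
  obtain hw | hw := le_or_gt (finrank F V) w
  · calc finrank F A ≤ finrank F (V →ₗ[F] W) := A.finrank_le
      _ = finrank F V * finrank F W := finrank_linearMap ..
      _ ≤ _ := by rw [mul_comm]; gcongr
  obtain ⟨f, hf⟩ := finrank_le_iff_exists_linearMap.1 hVW
  obtain ⟨H, -, hH, hker⟩ := exists_mrd_mem hVW (Nat.sub_le (finrank F V) w) (f := f)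
    (by rw [LinearMap.ker_eq_bot.2 hf, finrank_bot]; omega)
  have hdisj : Disjoint A H := Submodule.disjoint_def.2 fun g hgA hgH => by
    by_contra h0
    have := hA g hgA
    have := hker g hgH h0
    have := g.finrank_range_add_finrank_ker
    omega
  have hle := Submodule.finrank_add_finrank_le_of_disjoint hdisj
  rw [hH, finrank_linearMap, mul_comm (finrank F V), Nat.mul_sub] at hle
  have : finrank F W * w ≤ finrank F W * finrank F V := Nat.mul_le_mul_left _ hw.le
  omega

end Anticode

section Slice

variable {F V W : Type*} [Field F] [AddCommGroup V] [Module F V] [AddCommGroup W] [Module F W]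

theorem finrank_map_add_finrank_inf_ker [FiniteDimensional F V] (A : Submodule F V)
    (f : V →ₗ[F] W) :
    finrank F (A.map f) + finrank F (A ⊓ LinearMap.ker f : Submodule F V) = finrank F A := by
  have h := (f.domRestrict A).finrank_range_add_finrank_ker
  rw [LinearMap.range_domRestrict, LinearMap.ker_domRestrict,
    ← Submodule.finrank_map_subtype_eq A, Submodule.map_comap_subtype] at h
  exact h

theorem finrank_ker_dual_add_one [FiniteDimensional F V] {φ : Dual F V} (hφ : φ ≠ 0) :
    finrank F (LinearMap.ker φ) + 1 = finrank F V := by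
  have h := φ.finrank_range_add_finrank_ker
  rw [LinearMap.range_eq_top.2 (LinearMap.surjective hφ), finrank_top, finrank_self] at h
  omega

theorem smulRightₗ_injective {φ : Dual F V} (hφ : φ ≠ 0) :
    Function.Injective (LinearMap.smulRightₗ φ : W →ₗ[F] V →ₗ[F] W) := by
  obtain ⟨e, he⟩ : ∃ e, φ e = 1 := LinearMap.surjective hφ 1
  intro v v' h
  simpa only [LinearMap.smulRightₗ_apply_apply, he, one_smul] using LinearMap.congr_fun h e

theorem flip_smulRightₗ_injective {v : W} (hv : v ≠ 0) :
    Function.Injective ((LinearMap.smulRightₗ : Dual F V →ₗ[F] W →ₗ[F] _).flip v) :=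
  fun _ _ h => LinearMap.ext fun x => smul_left_injective F hv (LinearMap.congr_fun h x)

theorem finrank_range_smulRight_le_one (φ : Dual F V) (v : W) :
    finrank F (LinearMap.range (φ.smulRight v)) ≤ 1 := by
  have hspan : finrank F (F ∙ v) ≤ 1 := (finrank_span_le_card {v}).trans_eq (Set.toFinset_card _)
  refine (Submodule.finrank_mono ?_).trans hspan
  rintro _ ⟨x, rfl⟩
  exact Submodule.smul_mem _ _ (Submodule.mem_span_singleton_self v)

theorem ker_domRestrict'_ker {φ : Dual F V} (hφ : φ ≠ 0) :
    LinearMap.ker (LinearMap.domRestrict' (LinearMap.ker φ) : (V →ₗ[F] W) →ₗ[F] _) =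
      LinearMap.range (LinearMap.smulRightₗ φ : W →ₗ[F] V →ₗ[F] W) := by
  obtain ⟨e, he⟩ : ∃ e, φ e = 1 := LinearMap.surjective hφ 1
  ext f
  constructor
  · refine fun hf => ⟨f e, LinearMap.ext fun x => ?_⟩
    have hx : x - φ x • e ∈ LinearMap.ker φ := by
      rw [LinearMap.mem_ker, map_sub, map_smul, he, smul_eq_mul, mul_one, sub_self]
    have hfx : f (x - φ x • e) = 0 := LinearMap.congr_fun (LinearMap.mem_ker.1 hf) ⟨_, hx⟩
    rw [map_sub, map_smul, sub_eq_zero] at hfx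
    rw [LinearMap.smulRightₗ_apply_apply, hfx]
  · rintro ⟨v, rfl⟩
    refine LinearMap.mem_ker.2 (LinearMap.ext fun x => ?_)
    rw [LinearMap.domRestrict'_apply, LinearMap.smulRightₗ_apply_apply, LinearMap.mem_ker.1 x.2,
      zero_smul, LinearMap.zero_apply]

/-- The vectors `v` such that `A` contains the map `x ↦ φ x • v`. -/
def slice (A : Submodule F (V →ₗ[F] W)) (φ : Dual F V) : Submodule F W :=
  A.comap (LinearMap.smulRightₗ φ)

theorem mem_slice {A : Submodule F (V →ₗ[F] W)} {φ : Dual F V} {v : W} :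
    v ∈ slice A φ ↔ φ.smulRight v ∈ A := Iff.rfl

variable [FiniteDimensional F V]

theorem finrank_range_le_finrank_range_domRestrict_ker_add_one {φ : Dual F V} (hφ : φ ≠ 0)
    (f : V →ₗ[F] W) :
    finrank F (LinearMap.range f) ≤
      finrank F (LinearMap.range (f.domRestrict (LinearMap.ker φ))) + 1 := by
  have hV := f.finrank_range_add_finrank_ker
  have hK := (f.domRestrict (LinearMap.ker φ)).finrank_range_add_finrank_ker
  have hφ := finrank_ker_dual_add_one hφ
  have hle : finrank F (LinearMap.ker (f.domRestrict (LinearMap.ker φ))) ≤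
      finrank F (LinearMap.ker f) := by
    rw [LinearMap.ker_domRestrict, ← Submodule.finrank_map_subtype_eq]
    exact Submodule.finrank_mono (Submodule.map_comap_le _ _)
  omega

variable [FiniteDimensional F W]

theorem finrank_map_domRestrict'_add_finrank_slice (A : Submodule F (V →ₗ[F] W)) {φ : Dual F V}
    (hφ : φ ≠ 0) :
    finrank F (A.map (LinearMap.domRestrict' (LinearMap.ker φ))) + finrank F (slice A φ) =
      finrank F A := by
  rw [← finrank_map_add_finrank_inf_ker A (LinearMap.domRestrict' (LinearMap.ker φ)),
    ker_domRestrict'_ker hφ, inf_comm, ← Submodule.map_comap_eq, slice,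
    (Submodule.equivMapOfInjective _ (smulRightₗ_injective hφ) (A.comap _)).finrank_eq]

theorem finrank_comap_domRestrict' {φ : Dual F V} (hφ : φ ≠ 0)
    (B : Submodule F (LinearMap.ker φ →ₗ[F] W)) :
    finrank F (B.comap (LinearMap.domRestrict' (LinearMap.ker φ))) =
      finrank F B + finrank F W := by
  have hsurj : Function.Surjective
      (LinearMap.domRestrict' (LinearMap.ker φ) : (V →ₗ[F] W) →ₗ[F] _) := fun f =>
    (LinearMap.exists_extend f).imp fun _ => id
  rw [← finrank_map_add_finrank_inf_ker _ (LinearMap.domRestrict' (LinearMap.ker φ)),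
    Submodule.map_comap_eq_of_surjective hsurj, inf_eq_right.2 (LinearMap.ker_le_comap _),
    ker_domRestrict'_ker hφ, LinearMap.finrank_range_of_inj (smulRightₗ_injective hφ)]

end Slice

section Quotient

variable {F V W : Type*} [Field F] [AddCommGroup V] [Module F V] [AddCommGroup W] [Module F W]

theorem compRight_mkQ_surjective (S : Submodule F W) :
    Function.Surjective (LinearMap.compRight F S.mkQ : (V →ₗ[F] W) →ₗ[F] V →ₗ[F] W ⧸ S) := by
  obtain ⟨s, hs⟩ := S.mkQ.exists_rightInverse_of_surjective S.range_mkQ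
  refine fun g => ⟨s ∘ₗ g, ?_⟩
  rw [LinearMap.compRight_apply, ← LinearMap.comp_assoc, hs, LinearMap.id_comp]

variable [FiniteDimensional F W] {v : W} (hv : v ≠ 0)

include hv

theorem finrank_quotient_span_singleton_add_one : finrank F (W ⧸ F ∙ v) + 1 = finrank F W :=
  finrank_span_singleton (K := F) hv ▸ (F ∙ v).finrank_quotient_add_finrank

theorem finrank_map_mkQ_span_singleton_lt {U : Submodule F W} (hU : v ∈ U) :
    finrank F (U.map (F ∙ v).mkQ) < finrank F U := by
  have h := finrank_map_add_finrank_inf_ker U (F ∙ v).mkQ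
  rw [Submodule.ker_mkQ, inf_eq_right.2 ((Submodule.span_singleton_le_iff_mem v U).2 hU),
    finrank_span_singleton hv] at h
  omega

theorem finrank_le_finrank_map_compRight_mkQ_add [FiniteDimensional F V]
    (A : Submodule F (V →ₗ[F] W)) :
    finrank F A ≤ finrank F (A.map (LinearMap.compRight F (F ∙ v).mkQ)) + finrank F V := by
  let q : (V →ₗ[F] W) →ₗ[F] V →ₗ[F] W ⧸ F ∙ v := LinearMap.compRight F (F ∙ v).mkQ
  have hker : finrank F (LinearMap.ker q) = finrank F V := by
    have h := q.finrank_range_add_finrank_ker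
    rw [LinearMap.range_eq_top.2 (compRight_mkQ_surjective _), finrank_top, finrank_linearMap,
      finrank_linearMap, ← finrank_quotient_span_singleton_add_one hv] at h
    linarith
  rw [← finrank_map_add_finrank_inf_ker A q, ← hker]
  exact Nat.add_le_add_left (Submodule.finrank_mono inf_le_right) _

end Quotient

section AnticodeSlice

variable {F V W : Type*} [Field F] [AddCommGroup V] [Module F V] [AddCommGroup W] [Module F W]

theorem isAnticode_range_smulRightₗ (φ : Dual F V) :
    IsAnticode (LinearMap.range (LinearMap.smulRightₗ φ : W →ₗ[F] V →ₗ[F] W)) 1 := by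
  rintro _ ⟨v, rfl⟩
  exact finrank_range_smulRight_le_one φ v

theorem isAnticode_range_flip_smulRightₗ (v : W) :
    IsAnticode (LinearMap.range ((LinearMap.smulRightₗ : Dual F V →ₗ[F] W →ₗ[F] _).flip v)) 1 := by
  rintro _ ⟨φ, rfl⟩
  exact finrank_range_smulRight_le_one φ v

theorem exists_dual_apply_ne_zero {x : V} (hx : x ≠ 0) : ∃ φ : Dual F V, φ x ≠ 0 := by
  contrapose! hx
  exact (forall_dual_apply_eq_zero_iff F x).1 hx

theorem range_domRestrict_ker_eq {φ : Dual F V} {f : V →ₗ[F] W} {x : V} (hx : f x = 0)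
    (hφx : φ x ≠ 0) :
    LinearMap.range (f.domRestrict (LinearMap.ker φ)) = LinearMap.range f := by
  refine le_antisymm (LinearMap.range_domRestrict_le_range _ _) ?_
  rintro _ ⟨y, rfl⟩
  refine ⟨⟨y - (φ y / φ x) • x, ?_⟩, ?_⟩
  · rw [LinearMap.mem_ker, map_sub, map_smul, smul_eq_mul, div_mul_cancel₀ _ hφx, sub_self]
  · rw [LinearMap.domRestrict_apply, map_sub, map_smul, hx, smul_zero, sub_zero]

variable [FiniteDimensional F V] {A : Submodule F (V →ₗ[F] W)} {w : ℕ} (hA : IsAnticode A w)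
  {φ : Dual F V} (hφ : φ ≠ 0)

include hφ

theorem IsAnticode.comap_domRestrict' {B : Submodule F (LinearMap.ker φ →ₗ[F] W)}
    (hB : IsAnticode B w) :
    IsAnticode (B.comap (LinearMap.domRestrict' (LinearMap.ker φ))) (w + 1) := fun f hf =>
  (finrank_range_le_finrank_range_domRestrict_ker_add_one hφ f).trans
    (Nat.add_le_add_right (hB _ hf) 1)

include hA

/-- If `v` lay in the slice but not in the range, then `f` or `f + φ.smulRight v` would have rank
greater than `w`. -/
theorem IsAnticode.slice_le_range_domRestrict {f : V →ₗ[F] W} (hf : f ∈ A)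
    (hw : w ≤ finrank F (LinearMap.range (f.domRestrict (LinearMap.ker φ)))) :
    slice A φ ≤ LinearMap.range (f.domRestrict (LinearMap.ker φ)) := by
  intro v hv
  obtain ⟨e, he⟩ : ∃ e, φ e = 1 := LinearMap.surjective hφ 1
  have apply_mem : ∀ g ∈ A, g.domRestrict (LinearMap.ker φ) = f.domRestrict (LinearMap.ker φ) →
      g e ∈ LinearMap.range (f.domRestrict (LinearMap.ker φ)) := by
    intro g hg hgf
    have hle : LinearMap.range (f.domRestrict (LinearMap.ker φ)) ≤ LinearMap.range g :=
      hgf ▸ LinearMap.range_domRestrict_le_range _ _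
    exact Submodule.eq_of_le_of_finrank_le hle ((hA g hg).trans hw) ▸ ⟨e, rfl⟩
  have hadd : (f + φ.smulRight v).domRestrict (LinearMap.ker φ) =
      f.domRestrict (LinearMap.ker φ) := by
    ext ⟨x, hx⟩
    simp only [LinearMap.domRestrict_apply, LinearMap.add_apply, LinearMap.smulRight_apply,
      LinearMap.mem_ker.1 hx, zero_smul, add_zero]
  have hsub := Submodule.sub_mem _ (apply_mem _ (A.add_mem hf (mem_slice.1 hv)) hadd)
    (apply_mem f hf rfl)
  rwa [LinearMap.add_apply, LinearMap.smulRight_apply, he, one_smul, add_sub_cancel_left] at hsub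

variable [FiniteDimensional F W]

theorem IsAnticode.map_compRight_mkQ {v : W} (hv : v ∈ slice A φ) (hv0 : v ≠ 0) :
    IsAnticode ((A.map (LinearMap.domRestrict' (LinearMap.ker φ))).map
      (LinearMap.compRight F (F ∙ v).mkQ)) (w - 1) := by
  rintro _ ⟨_, ⟨f, hf, rfl⟩, rfl⟩
  have hU : finrank F (LinearMap.range (f.domRestrict (LinearMap.ker φ))) ≤ w :=
    (Submodule.finrank_mono (LinearMap.range_domRestrict_le_range _ _)).trans (hA f hf)
  suffices h : finrank F ((LinearMap.range (f.domRestrict (LinearMap.ker φ))).map (F ∙ v).mkQ)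
      ≤ w - 1 by rwa [← LinearMap.range_comp] at h
  obtain h | h := hU.lt_or_eq
  · exact (Submodule.finrank_map_le _ _).trans (Nat.le_sub_one_of_lt h)
  · have hlt := finrank_map_mkQ_span_singleton_lt hv0
      (hA.slice_le_range_domRestrict hφ hf h.ge hv)
    exact Nat.le_sub_one_of_lt (hlt.trans_le hU)

variable [Finite F] (hVW : finrank F V ≤ finrank F W)

include hVW

theorem IsAnticode.finrank_le_of_slice_ne_bot (hs : slice A φ ≠ ⊥) :
    finrank F A + 1 ≤ (finrank F W - 1) * (w - 1) + finrank F V + finrank F (slice A φ) := by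
  obtain ⟨v, hv, hv0⟩ := Submodule.exists_mem_ne_zero_of_ne_bot hs
  have hK := finrank_ker_dual_add_one hφ
  have hQ := finrank_quotient_span_singleton_add_one (F := F) hv0
  have hle := (hA.map_compRight_mkQ hφ hv hv0).finrank_le (by omega)
  have hR := finrank_le_finrank_map_compRight_mkQ_add hv0
    (A.map (LinearMap.domRestrict' (LinearMap.ker φ)))
  rw [show finrank F W - 1 = finrank F (W ⧸ F ∙ v) by omega,
    ← finrank_map_domRestrict'_add_finrank_slice A hφ]
  omega

end AnticodeSlice

section Rigid

variable {F V W : Type*} [Field F] [AddCommGroup V] [Module F V] [AddCommGroup W] [Module F W]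
  {A : Submodule F (V →ₗ[F] W)}

theorem disjoint_range_smulRightₗ {φ : Dual F V}
    (hs : slice A φ = ⊥) : Disjoint A (LinearMap.range (LinearMap.smulRightₗ φ)) := by
  rw [disjoint_iff, inf_comm, ← Submodule.map_comap_eq]
  change (slice A φ).map _ = ⊥
  rw [hs, Submodule.map_bot]

variable [FiniteDimensional F V] {w : ℕ} (hA : IsAnticode A w)

include hA

theorem IsAnticode.slice_le_range {f : V →ₗ[F] W} (hf : f ∈ A)
    (hfw : finrank F (LinearMap.range f) = w) {x : V} (hx : f x = 0) {φ : Dual F V}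
    (hφx : φ x ≠ 0) : slice A φ ≤ LinearMap.range f := by
  have hφ : φ ≠ 0 := fun h => hφx (by rw [h, LinearMap.zero_apply])
  have hr := range_domRestrict_ker_eq hx hφx
  exact (hA.slice_le_range_domRestrict hφ hf (hr.symm ▸ hfw.ge)).trans_eq hr

variable [FiniteDimensional F W] (hdim : ∀ φ : Dual F V, φ ≠ 0 → finrank F (slice A φ) = w)

include hdim

/-- If `φ` kills the kernel vector `x` of `f`, then compare the slices of `φ₁` and `φ + φ₁`
for a functional `φ₁` that does not. -/
theorem IsAnticode.slice_eq_range {f : V →ₗ[F] W} (hf : f ∈ A)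
    (hfw : finrank F (LinearMap.range f) = w) {x : V} (hx : f x = 0) (hx0 : x ≠ 0)
    {φ : Dual F V} (hφ : φ ≠ 0) : slice A φ = LinearMap.range f := by
  have eq_of_ne {ψ : Dual F V} (hψx : ψ x ≠ 0) : slice A ψ = LinearMap.range f :=
    Submodule.eq_of_le_of_finrank_eq (hA.slice_le_range hf hfw hx hψx)
      ((hdim ψ fun h => hψx (by rw [h, LinearMap.zero_apply])).trans hfw.symm)
  by_cases hφx : φ x = 0
  · obtain ⟨φ₁, hφ₁⟩ := exists_dual_apply_ne_zero (F := F) hx0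
    have hsum := eq_of_ne (ψ := φ + φ₁) (by rwa [LinearMap.add_apply, hφx, zero_add])
    refine (Submodule.eq_of_le_of_finrank_eq (fun u hu => ?_)
      (hfw.trans (hdim φ hφ).symm)).symm
    have hsub := A.sub_mem (mem_slice.1 (hsum.ge hu)) (mem_slice.1 ((eq_of_ne hφ₁).ge hu))
    have heq : (φ + φ₁).smulRight u - φ₁.smulRight u = φ.smulRight u := by
      ext y
      simp only [LinearMap.sub_apply, LinearMap.smulRight_apply, LinearMap.add_apply, add_smul,
        add_sub_cancel_right]
    exact mem_slice.2 (heq ▸ hsub)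
  · exact eq_of_ne hφx

end Rigid

section Extension

variable {F V W : Type*} [Field F] [AddCommGroup V] [Module F V] [FiniteDimensional F V]
  [AddCommGroup W] [Module F W] [FiniteDimensional F W]

theorem IsAnticode.exists_le_of_disjoint {A E : Submodule F (V →ₗ[F] W)} {w : ℕ}
    (hA : IsAnticode A w) (hE : IsAnticode E 1) (hAE : Disjoint A E) :
    ∃ B, A ≤ B ∧ IsAnticode B (w + 1) ∧ finrank F A + finrank F E ≤ finrank F B := by
  refine ⟨A ⊔ E, le_sup_left, hA.sup hE, ?_⟩
  have h := Submodule.finrank_sup_add_finrank_inf_eq A E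
  rw [hAE.eq_bot, finrank_bot] at h
  exact h.ge

variable [Finite F] (hVW : finrank F V ≤ finrank F W)

include hVW

theorem IsAnticode.finrank_slice_eq {A : Submodule F (V →ₗ[F] W)} {w : ℕ}
    (hA : IsAnticode A w) (hdim : finrank F W * w ≤ finrank F A) {φ : Dual F V} (hφ : φ ≠ 0)
    (hslice : slice A φ ≠ ⊥) {f : V →ₗ[F] W} (hf : f ∈ A)
    (hfw : w ≤ finrank F (LinearMap.range (f.domRestrict (LinearMap.ker φ)))) :
    finrank F (slice A φ) = w ∧ finrank F V = finrank F W := by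
  have hσ : finrank F (slice A φ) ≤ w :=
    (Submodule.finrank_mono ((hA.slice_le_range_domRestrict hφ hf hfw).trans
      (LinearMap.range_domRestrict_le_range f _))).trans (hA f hf)
  have hσ0 := Submodule.one_le_finrank_iff.2 hslice
  have hle := hA.finrank_le_of_slice_ne_bot hφ hVW hslice
  have hK := finrank_ker_dual_add_one hφ
  obtain ⟨w, rfl⟩ := Nat.exists_eq_add_of_le' (hσ0.trans hσ)
  obtain ⟨m, hm⟩ := Nat.exists_eq_add_of_le' (show 1 ≤ finrank F W by omega)
  rw [hm] at hVW hle hdim ⊢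
  rw [Nat.add_sub_cancel, Nat.add_sub_cancel] at hle
  rw [add_mul, mul_add] at hdim
  omega

/-- Dimension counting forces every slice of `A` to have dimension `w`, so all slices equal the
range of any member of `A` of rank `w`, and `A` avoids the rank one maps onto a line outside it. -/
theorem IsAnticode.exists_disjoint_of_forall_slice_ne_bot {A : Submodule F (V →ₗ[F] W)} {w : ℕ}
    (hA : IsAnticode A w) (hw : w < finrank F V) (hdim : finrank F W * w ≤ finrank F A)
    (hslice : ∀ φ : Dual F V, φ ≠ 0 → slice A φ ≠ ⊥)
    (hrank : ∀ φ : Dual F V, φ ≠ 0 →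
      ∃ f ∈ A, w ≤ finrank F (LinearMap.range (f.domRestrict (LinearMap.ker φ)))) :
    ∃ E : Submodule F (V →ₗ[F] W), IsAnticode E 1 ∧ Disjoint A E ∧ finrank F W ≤ finrank F E := by
  have slice_bounds (φ : Dual F V) (hφ : φ ≠ 0) :
      finrank F (slice A φ) = w ∧ finrank F V = finrank F W := by
    obtain ⟨f, hf, hfw⟩ := hrank φ hφ
    exact hA.finrank_slice_eq hVW hdim hφ (hslice φ hφ) hf hfw
  obtain ⟨x₀, hx₀⟩ := finrank_pos_iff_exists_ne_zero.1 (show 0 < finrank F V by omega)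
  obtain ⟨φ₀, hφ₀x⟩ := exists_dual_apply_ne_zero (F := F) hx₀
  have hφ₀ : φ₀ ≠ 0 := fun h => hφ₀x (by rw [h, LinearMap.zero_apply])
  have hVW' := (slice_bounds φ₀ hφ₀).2
  obtain ⟨f, hf, hfw⟩ := hrank φ₀ hφ₀
  replace hfw : finrank F (LinearMap.range f) = w := le_antisymm (hA f hf)
    (hfw.trans (Submodule.finrank_mono (LinearMap.range_domRestrict_le_range f _)))
  have hker := f.finrank_range_add_finrank_ker
  obtain ⟨x, hx, hx0⟩ := Submodule.exists_mem_ne_zero_of_ne_bot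
    (Submodule.one_le_finrank_iff.1 (show 1 ≤ finrank F (LinearMap.ker f) by omega))
  obtain ⟨v, hv⟩ : ∃ v, v ∉ LinearMap.range f := by
    by_contra! h
    rw [Submodule.eq_top_iff'.2 h, finrank_top] at hfw
    omega
  refine ⟨_, isAnticode_range_flip_smulRightₗ v, Submodule.disjoint_def.2 ?_, ?_⟩
  · rintro _ hmem ⟨φ, rfl⟩
    by_contra hφv
    have hφ : φ ≠ 0 := fun h => hφv (by rw [h, map_zero])
    exact hv (hA.slice_eq_range (fun ψ hψ => (slice_bounds ψ hψ).1) hf hfw hx hx0 hφ ▸ hmem)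
  · have hv0 : v ≠ 0 := fun h => hv (h ▸ Submodule.zero_mem _)
    rw [LinearMap.finrank_range_of_inj (flip_smulRightₗ_injective hv0), Subspace.dual_finrank_eq,
      hVW']

end Extension

theorem IsAnticode.exists_le_succ {F V W : Type*} [Field F] [Finite F]
    [AddCommGroup V] [Module F V] [FiniteDimensional F V]
    [AddCommGroup W] [Module F W] [FiniteDimensional F W] (hVW : finrank F V ≤ finrank F W)
    {A : Submodule F (V →ₗ[F] W)} {w : ℕ} (hA : IsAnticode A w) (hw : w < finrank F V)
    (hdim : finrank F W * w ≤ finrank F A) :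
    ∃ B, A ≤ B ∧ IsAnticode B (w + 1) ∧ finrank F W * (w + 1) ≤ finrank F B := by
  induction hn : finrank F V using Nat.strong_induction_on generalizing V w with
  | _ n ih =>
  have extend {E : Submodule F (V →ₗ[F] W)} (hE : IsAnticode E 1) (hAE : Disjoint A E)
      (hWE : finrank F W ≤ finrank F E) :
      ∃ B, A ≤ B ∧ IsAnticode B (w + 1) ∧ finrank F W * (w + 1) ≤ finrank F B := by
    obtain ⟨B, hAB, hB, hle⟩ := hA.exists_le_of_disjoint hE hAE
    exact ⟨B, hAB, hB, by rw [mul_add_one]; omega⟩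
  by_cases hslice : ∀ φ : Dual F V, φ ≠ 0 → slice A φ ≠ ⊥
  · by_cases hrank : ∀ φ : Dual F V, φ ≠ 0 →
        ∃ f ∈ A, w ≤ finrank F (LinearMap.range (f.domRestrict (LinearMap.ker φ)))
    · obtain ⟨E, hE, hAE, hWE⟩ :=
        hA.exists_disjoint_of_forall_slice_ne_bot hVW hw hdim hslice hrank
      exact extend hE hAE hWE
    · push Not at hrank
      obtain ⟨φ, hφ, hlt⟩ := hrank
      have hK := finrank_ker_dual_add_one hφ
      obtain ⟨w, rfl⟩ := Nat.exists_eq_add_one.2 (Nat.zero_lt_of_lt (hlt 0 A.zero_mem))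
      let R : (V →ₗ[F] W) →ₗ[F] LinearMap.ker φ →ₗ[F] W :=
        LinearMap.domRestrict' (LinearMap.ker φ)
      have hR : IsAnticode (A.map R) w := by
        rintro _ ⟨f, hf, rfl⟩
        exact Nat.lt_succ_iff.1 (hlt f hf)
      have hRdim : finrank F W * w ≤ finrank F (A.map R) := by
        have : finrank F (A.map R) + finrank F (slice A φ) = finrank F A :=
          finrank_map_domRestrict'_add_finrank_slice A hφ
        have := (slice A φ).finrank_le
        rw [mul_add_one] at hdim
        omega
      obtain ⟨B, hAB, hB, hBdim⟩ := ih _ (by omega) (by omega) hR (by omega) hRdim rfl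
      refine ⟨_, Submodule.map_le_iff_le_comap.1 hAB, hB.comap_domRestrict' hφ, ?_⟩
      rw [finrank_comap_domRestrict' hφ, mul_add_one]
      omega
  · push Not at hslice
    obtain ⟨φ, hφ, hs⟩ := hslice
    refine extend (isAnticode_range_smulRightₗ φ) (disjoint_range_smulRightₗ hs) ?_
    rw [LinearMap.finrank_range_of_inj (smulRightₗ_injective hφ)]

section FullRankFactorization

variable {F ι κ : Type*} [Field F] [Fintype κ]

theorem exists_surjective_comp_eq {V W : Type*} [AddCommGroup V] [Module F V]
    [FiniteDimensional F V] [AddCommGroup W] [Module F W] {f : V →ₗ[F] W} {w : ℕ}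
    (hf : finrank F (LinearMap.range f) ≤ w) (hw : w ≤ finrank F V) :
    ∃ (g : V →ₗ[F] Fin w → F) (h : (Fin w → F) →ₗ[F] W), Function.Surjective g ∧ h ∘ₗ g = f := by
  have hker := f.finrank_range_add_finrank_ker
  obtain ⟨v, hv⟩ := exists_linearIndependent_of_le_finrank (R := F) (M := LinearMap.ker f)
    (n := finrank F V - w) (by omega)
  set K := (Submodule.span F (Set.range v)).map (LinearMap.ker f).subtype
  have hKf : K ≤ LinearMap.ker f := Submodule.map_subtype_le _ _
  have hK := K.finrank_quotient_add_finrank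
  rw [Submodule.finrank_map_subtype_eq, finrank_span_eq_card hv, Fintype.card_fin] at hK
  obtain ⟨e⟩ := FiniteDimensional.nonempty_linearEquiv_of_finrank_eq
    (show finrank F (V ⧸ K) = finrank F (Fin w → F) by rw [finrank_fin_fun]; omega)
  refine ⟨e.toLinearMap ∘ₗ K.mkQ, K.liftQ f hKf ∘ₗ e.symm.toLinearMap,
    e.surjective.comp K.mkQ_surjective, LinearMap.ext fun x => ?_⟩
  simp only [LinearMap.comp_apply, LinearEquiv.coe_coe, LinearEquiv.symm_apply_apply,
    Submodule.mkQ_apply, Submodule.liftQ_apply]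

theorem exists_mul_eq_of_rank_le {N : Matrix ι κ F} {w : ℕ} (hN : N.rank ≤ w)
    (hw : w ≤ Fintype.card κ) :
    ∃ (Y : Matrix ι (Fin w) F) (Q : Matrix (Fin w) κ F), Y * Q = N ∧ Q.rank = w := by
  classical
  obtain ⟨g, h, hg, hN⟩ := exists_surjective_comp_eq (f := N.toLin') hN (by simpa using hw)
  refine ⟨h.toMatrix', g.toMatrix', ?_, ?_⟩
  · rw [← LinearMap.toMatrix'_comp, hN, LinearMap.toMatrix'_toLin']
  · change finrank F (LinearMap.range g.toMatrix'.toLin') = w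
    rw [Matrix.toLin'_toMatrix', LinearMap.range_eq_top.2 hg, finrank_top, finrank_fin_fun]

end FullRankFactorization

section Duality

variable {F ι κ : Type*} [Field F] [Fintype ι] [Fintype κ]

/-- The entrywise scalar product of matrices, which is the bilinear form behind duality of
rank-metric codes. -/
noncomputable def traceProduct (F ι κ : Type*) [Field F] [Fintype ι] [Fintype κ] :
    LinearMap.BilinForm F (Matrix ι κ F) :=
  LinearMap.mk₂ F (fun M N => (M.transpose * N).trace)
    (fun M M' N => by rw [Matrix.transpose_add, Matrix.add_mul, Matrix.trace_add])
    (fun c M N => by rw [Matrix.transpose_smul, Matrix.smul_mul, Matrix.trace_smul])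
    (fun M N N' => by rw [Matrix.mul_add, Matrix.trace_add])
    (fun c M N => by rw [Matrix.mul_smul, Matrix.trace_smul])

theorem traceProduct_apply (M N : Matrix ι κ F) :
    traceProduct F ι κ M N = (M.transpose * N).trace := rfl

theorem isSymm_traceProduct : (traceProduct F ι κ).IsSymm :=
  ⟨fun M N => by
    rw [traceProduct_apply, traceProduct_apply, ← Matrix.trace_transpose, Matrix.transpose_mul,
      Matrix.transpose_transpose]⟩

theorem nondegenerate_traceProduct : (traceProduct F ι κ).Nondegenerate := by
  classical
  refine (LinearMap.IsRefl.nondegenerate_iff_separatingLeft (B := traceProduct F ι κ)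
    isSymm_traceProduct.isRefl).2 fun M hM => ?_
  refine Matrix.transpose_eq_zero.1 (Matrix.ext_iff_trace_mul_right.2 fun N => ?_)
  rw [Matrix.zero_mul, Matrix.trace_zero]
  exact hM N

theorem finrank_add_finrank_orthogonal_traceProduct (A : Submodule F (Matrix ι κ F)) :
    finrank F A + finrank F ((traceProduct F ι κ).orthogonal A) =
      Fintype.card ι * Fintype.card κ := by
  have h := LinearMap.BilinForm.finrank_orthogonal nondegenerate_traceProduct A
  have hA := A.finrank_le
  rw [finrank_matrix, finrank_self, mul_one] at h hA
  rw [h, Nat.add_sub_cancel' hA]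

/-- A full rank factorization `N = Y * Q` reduces orthogonality of `N` to the bijectivity of the
map `X ↦ X * Qᵀ` on the code. -/
theorem eq_zero_of_mem_orthogonal_of_rank_le {H : Submodule F (Matrix ι κ F)} {w : ℕ}
    (hw : w ≤ Fintype.card κ) (hdim : Fintype.card ι * w ≤ finrank F H)
    (hH : ∀ M ∈ H, M.rank + w ≤ Fintype.card κ → M = 0) {N : Matrix ι κ F}
    (hN : N ∈ (traceProduct F ι κ).orthogonal H) (hrank : N.rank ≤ w) : N = 0 := by
  obtain ⟨Y, Q, rfl, hQ⟩ := exists_mul_eq_of_rank_le hrank hw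
  let R : H →ₗ[F] Matrix ι (Fin w) F := (mulRightLinearMap ι F Q.transpose).domRestrict H
  have hinj : Function.Injective R := (injective_iff_map_eq_zero R).2 fun X hX => by
    have hrank := Matrix.rank_add_rank_le_card_of_mul_eq_zero (show X.1 * Q.transpose = 0 from hX)
    rw [Matrix.rank_transpose, hQ] at hrank
    exact Subtype.ext (hH X X.2 hrank)
  have hrange : LinearMap.range R = ⊤ := by
    refine Submodule.eq_top_of_finrank_eq (le_antisymm (Submodule.finrank_le _) ?_)
    rwa [LinearMap.finrank_range_of_inj hinj, finrank_matrix, finrank_self, mul_one,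
      Fintype.card_fin]
  suffices hY : Y = 0 by rw [hY, Matrix.zero_mul]
  refine Matrix.ext_iff_trace_mul_left.2 fun Z => ?_
  obtain ⟨X, hX : X.1 * Q.transpose = Z.transpose⟩ := LinearMap.range_eq_top.1 hrange Z.transpose
  calc (Z * Y).trace = ((X.1 * Q.transpose).transpose * Y).trace := by
        rw [hX, Matrix.transpose_transpose]
    _ = (X.1.transpose * (Y * Q)).trace := by
        rw [Matrix.transpose_mul, Matrix.transpose_transpose, Matrix.mul_assoc,
          Matrix.trace_mul_comm, Matrix.mul_assoc]
    _ = (Z * (0 : Matrix ι (Fin w) F)).trace := by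
        rw [Matrix.mul_zero, Matrix.trace_zero]
        exact hN X X.2

theorem disjoint_orthogonal {V : Type*} [AddCommGroup V] [Module F V] [FiniteDimensional F V]
    {B : LinearMap.BilinForm F V} (hB : B.Nondegenerate) {P Q : Submodule F V}
    (hPQ : Disjoint P Q) (hdim : finrank F V ≤ finrank F P + finrank F Q) :
    Disjoint (B.orthogonal P) (B.orthogonal Q) := by
  have htop : P ⊔ Q = ⊤ := by
    have h := Submodule.finrank_sup_add_finrank_inf_eq P Q
    rw [hPQ.eq_bot, finrank_bot] at h
    exact Submodule.eq_top_of_finrank_eq (le_antisymm (Submodule.finrank_le _) (by omega))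
  refine Submodule.disjoint_def.2 fun x hP hQ => hB.2 x fun y => ?_
  obtain ⟨p, hp, q, hq, rfl⟩ := Submodule.mem_sup.1 (htop ▸ Submodule.mem_top : y ∈ P ⊔ Q)
  rw [map_add, LinearMap.add_apply, hP p hp, hQ q hq, add_zero]

end Duality

section MatrixCode

variable {F : Type*} [Field F] {m n : ℕ}

/-- The code `C`, viewed as a space of linear maps. -/
def linCode (C : Submodule F (Matrix (Fin m) (Fin n) F)) :
    Submodule F ((Fin n → F) →ₗ[F] Fin m → F) :=
  C.map (Matrix.toLin' : _ ≃ₗ[F] _).toLinearMap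

variable {A C : Submodule F (Matrix (Fin m) (Fin n) F)} {w : ℕ}

theorem exists_linCode_eq (B : Submodule F ((Fin n → F) →ₗ[F] Fin m → F)) :
    ∃ C, linCode C = B :=
  ⟨_, Submodule.map_comap_eq_of_surjective Matrix.toLin'.surjective B⟩

theorem toLin'_mem_linCode {M : Matrix (Fin m) (Fin n) F} : M.toLin' ∈ linCode C ↔ M ∈ C :=
  Matrix.toLin'.injective.mem_set_image

theorem linCode_le_linCode : linCode A ≤ linCode C ↔ A ≤ C :=
  Submodule.map_le_map_iff_of_injective Matrix.toLin'.injective A C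

theorem finrank_linCode : finrank F (linCode C) = finrank F C :=
  LinearEquiv.finrank_map_eq _ C

theorem maxRank_le_iff : maxRank C ≤ w ↔ ∀ M ∈ C, M.rank ≤ w := by
  refine ⟨fun h M hM => ((isGreatest_maxRank C).2 ⟨M, hM, rfl⟩).trans h, fun h => ?_⟩
  obtain ⟨M, hM, hr⟩ := (isGreatest_maxRank C).1
  exact hr ▸ h M hM

theorem isAnticode_linCode_iff : IsAnticode (linCode C) w ↔ maxRank C ≤ w := by
  rw [maxRank_le_iff]
  constructor
  · exact fun h M hM => h _ (toLin'_mem_linCode.2 hM)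
  · rintro h _ ⟨M, hM, rfl⟩
    exact h M hM

variable [Finite F] (hnm : n ≤ m)

include hnm

theorem finrank_le_of_maxRank_le (hA : maxRank A ≤ w) : finrank F A ≤ m * w := by
  have h := (isAnticode_linCode_iff.2 hA).finrank_le (by simpa using hnm)
  rwa [finrank_linCode, finrank_fin_fun] at h

theorem exists_le_maxRank_le_succ (hA : maxRank A ≤ w) (hw : w < n) (hdim : m * w ≤ finrank F A) :
    ∃ B, A ≤ B ∧ maxRank B ≤ w + 1 ∧ m * (w + 1) ≤ finrank F B := by
  obtain ⟨B, hAB, hB, hdimB⟩ := (isAnticode_linCode_iff.2 hA).exists_le_succ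
    (by simpa using hnm) (by simpa using hw) (by rwa [finrank_linCode, finrank_fin_fun])
  obtain ⟨B, rfl⟩ := exists_linCode_eq B
  rw [finrank_linCode, finrank_fin_fun] at hdimB
  exact ⟨B, linCode_le_linCode.1 hAB, isAnticode_linCode_iff.1 hB, hdimB⟩

theorem exists_mrd_code_mem {N : Matrix (Fin m) (Fin n) F} {s : ℕ} (hs : s ≤ n)
    (hN : n < N.rank + s) :
    ∃ H : Submodule F (Matrix (Fin m) (Fin n) F), N ∈ H ∧ finrank F H = m * s ∧
      ∀ M ∈ H, M.rank + s ≤ n → M = 0 := by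
  have rank_add_finrank_ker (M : Matrix (Fin m) (Fin n) F) :
      M.rank + finrank F (LinearMap.ker M.toLin') = n :=
    M.toLin'.finrank_range_add_finrank_ker.trans (finrank_fin_fun F)
  have hker := rank_add_finrank_ker N
  obtain ⟨H, hNH, hdim, hH⟩ := exists_mrd_mem (f := N.toLin') (s := s) (by simpa using hnm)
    (by simpa using hs) (by omega)
  obtain ⟨H, rfl⟩ := exists_linCode_eq H
  rw [finrank_linCode, finrank_fin_fun] at hdim
  refine ⟨H, toLin'_mem_linCode.1 hNH, hdim, fun M hM hrank => ?_⟩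
  by_contra h0
  have := hH _ (toLin'_mem_linCode.2 hM) fun h => h0 (Matrix.toLin'.map_eq_zero_iff.1 h)
  have := rank_add_finrank_ker M
  omega

theorem maxRank_orthogonal_le (hA : maxRank A ≤ w) (hw : w ≤ n) (hdim : m * w ≤ finrank F A) :
    maxRank ((traceProduct F (Fin m) (Fin n)).orthogonal A) ≤ n - w := by
  refine maxRank_le_iff.2 fun N hN => ?_
  by_contra! hrank
  obtain ⟨H, hNH, hdimH, hH⟩ := exists_mrd_code_mem hnm hw (N := N) (by omega)
  have hdisj : Disjoint A ((traceProduct F _ _).orthogonal H) :=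
    Submodule.disjoint_def.2 fun M hMA hMH => eq_zero_of_mem_orthogonal_of_rank_le
      (by simpa using hw) (by simpa using hdimH.ge) (by simpa using hH) hMH
      (maxRank_le_iff.1 hA M hMA)
  have h := finrank_add_finrank_orthogonal_traceProduct H
  have hdisj' := disjoint_orthogonal nondegenerate_traceProduct hdisj
    (by rw [finrank_matrix, finrank_self]; omega)
  rw [LinearMap.BilinForm.orthogonal_orthogonal nondegenerate_traceProduct
    isSymm_traceProduct.isRefl] at hdisj'
  rw [Submodule.disjoint_def.1 hdisj' N hN hNH, Matrix.rank_zero] at hrank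
  exact Nat.not_lt_zero _ hrank

theorem exists_le_maxRank_le_of_succ (hA : maxRank A ≤ w + 1) (hw : w < n)
    (hdim : finrank F A = m * (w + 1)) : ∃ A' ≤ A, maxRank A' ≤ w ∧ m * w ≤ finrank F A' := by
  obtain ⟨u, hu⟩ := Nat.exists_eq_add_of_lt hw
  have hsplit : m * n = m * w + m * u + m := by rw [hu]; ring
  have hdual := finrank_add_finrank_orthogonal_traceProduct A
  rw [Fintype.card_fin, Fintype.card_fin, hdim, mul_add_one] at hdual
  obtain ⟨B, hAB, hB, hdimB⟩ := exists_le_maxRank_le_succ hnm (w := u)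
    ((maxRank_orthogonal_le hnm hA hw hdim.ge).trans_eq (by omega)) (by omega) (by omega)
  have hB' := finrank_le_of_maxRank_le hnm hB
  have hdualB := finrank_add_finrank_orthogonal_traceProduct B
  rw [Fintype.card_fin, Fintype.card_fin] at hdualB
  rw [mul_add_one] at hB'
  refine ⟨(traceProduct F _ _).orthogonal B, ?_,
    (maxRank_orthogonal_le hnm hB (by omega) hdimB).trans_eq (by omega), by omega⟩
  have hle := (traceProduct F _ _).orthogonal_le hAB
  rwa [LinearMap.BilinForm.orthogonal_orthogonal nondegenerate_traceProduct
    isSymm_traceProduct.isRefl] at hle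

end MatrixCode

section GenWeight

variable {F : Type*} [Field F] {m n : ℕ} (hnm : n ≤ m)
  (C : Submodule F (Matrix (Fin m) (Fin n) F))

include hnm

theorem genWeight_le {r : ℕ} (hr : r ≤ finrank F C) : genWeight C r ≤ n :=
  ((isLeast_genWeight C hr).2 ⟨C, le_rfl, hr, rfl⟩).trans
    ((isLeast_weight hnm C).2 ⟨⊤, le_top, isOptimalAnticode_top hnm, maxRank_top hnm⟩)

theorem exists_le_optimalAnticode_maxRank_eq_genWeight {r : ℕ} (hr : r ≤ finrank F C) :
    ∃ D A : Submodule F (Matrix (Fin m) (Fin n) F), D ≤ C ∧ r ≤ finrank F D ∧ D ≤ A ∧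
      IsOptimalAnticode A ∧ maxRank A = genWeight C r := by
  obtain ⟨D, hDC, hD, hDw⟩ := (isLeast_genWeight C hr).1
  obtain ⟨A, hDA, hA, hAw⟩ := (isLeast_weight hnm D).1
  exact ⟨D, A, hDC, hD, hDA, hA, hAw.trans hDw⟩

variable {C} in
theorem le_genWeight_of_le_rank {G : Submodule F (Matrix (Fin m) (Fin n) F)} {r w : ℕ}
    (hGC : G ≤ C) (hG : ∀ M ∈ G, M ≠ 0 → w ≤ M.rank) (hr : r ≤ finrank F C)
    (hdim : finrank F C < r + finrank F G) : w ≤ genWeight C r := by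
  obtain ⟨D, A, hDC, hD, hDA, -, hAw⟩ := exists_le_optimalAnticode_maxRank_eq_genWeight hnm C hr
  by_contra! hlt
  have hdisj : Disjoint D G := Submodule.disjoint_def.2 fun M hMD hMG => by
    by_contra h0
    have hMA := maxRank_le_iff.1 hAw.le M (hDA hMD)
    exact absurd (hG M hMG h0) (hMA.trans_lt hlt).not_ge
  have hsup := Submodule.finrank_sup_add_finrank_inf_eq D G
  have hle := Submodule.finrank_mono (sup_le hDC hGC)
  rw [hdisj.eq_bot, finrank_bot] at hsup
  omega

variable [Finite F] (hm : 0 < m)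

include hm

theorem genWeight_le_of_le {C D A : Submodule F (Matrix (Fin m) (Fin n) F)} {r w : ℕ}
    (hDC : D ≤ C) (hr : r ≤ finrank F D) (hDA : D ≤ A) (hA : maxRank A ≤ w)
    (hdim : m * w ≤ finrank F A) : genWeight C r ≤ w := by
  have hmax := finrank_le_of_maxRank_le hnm (le_refl (maxRank A))
  have hw : maxRank A = w := le_antisymm hA (Nat.le_of_mul_le_mul_left (hdim.trans hmax) hm)
  have hopt : IsOptimalAnticode A := le_antisymm hmax (hw ▸ hdim)
  exact ((isLeast_genWeight C (hr.trans (Submodule.finrank_mono hDC))).2 ⟨D, hDC, hr, rfl⟩).trans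
    ((isLeast_weight hnm D).2 ⟨A, hDA, hopt, hw⟩)

theorem genWeight_lt_genWeight {r s : ℕ} (hrs : r + m ≤ s) (hs : s ≤ finrank F C) :
    genWeight C r < genWeight C s := by
  obtain ⟨D, A, hDC, hD, hDA, hA, hAw⟩ :=
    exists_le_optimalAnticode_maxRank_eq_genWeight hnm C hs
  have hdimA : finrank F A = m * maxRank A := hA
  have hDA' := Submodule.finrank_mono hDA
  obtain ⟨w, hw⟩ : ∃ w, maxRank A = w + 1 := by
    refine Nat.exists_eq_succ_of_ne_zero fun h => ?_
    rw [h, mul_zero] at hdimA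
    omega
  rw [hw] at hdimA
  have hwn : w < n := by
    have := genWeight_le hnm C hs
    omega
  obtain ⟨A', hA'A, hA', hdimA'⟩ := exists_le_maxRank_le_of_succ hnm hw.le hwn hdimA
  have hcut : r ≤ finrank F (D ⊓ A' : Submodule F _) := by
    have := Submodule.finrank_sup_add_finrank_inf_eq D A'
    have := Submodule.finrank_mono (sup_le hDA hA'A)
    rw [mul_add_one] at hdimA
    omega
  rw [← hAw, hw, Nat.lt_succ_iff]
  exact genWeight_le_of_le hnm hm (inf_le_left.trans hDC) hcut inf_le_right hA' hdimA'

end GenWeight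

section GradedBasis

theorem finrank_span_image {R ι M : Type*} [Ring R] [StrongRankCondition R] [AddCommGroup M]
    [Module R M] {v : ι → M} (hv : LinearIndependent R v) (s : Set ι) :
    finrank R (Submodule.span R (v '' s)) = s.ncard := by
  rw [finrank, ← Cardinal.toNat_toENat, toENat_rank_span_set (hv.linearIndepOn s), Set.ncard]

theorem ncard_setOf_val_lt (n w : ℕ) : {j : Fin n | (j : ℕ) < w}.ncard = min n w := by
  rw [Set.ncard_eq_toFinset_card', Set.toFinset_ofPred, Fin.card_filter_val_lt]

theorem ncard_setOf_snd_lt (m n w : ℕ) :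
    {p : Fin m × Fin n | (p.2 : ℕ) < w}.ncard = m * min n w := by
  have hprod : {p : Fin m × Fin n | (p.2 : ℕ) < w} = Set.univ ×ˢ {j : Fin n | (j : ℕ) < w} :=
    (Set.univ_prod (t := {j : Fin n | (j : ℕ) < w})).symm
  rw [hprod, Set.ncard_prod, Set.ncard_univ, Nat.card_fin, ncard_setOf_val_lt]

variable {F V L : Type*} [Field F] [AddCommGroup V] [Module F V] [Field L] [Algebra F L] {n : ℕ}

theorem linearIndependent_of_triangular (b : Fin n → V) {g : Fin n → V →ₗ[F] L}
    (hlt : ∀ j l, j < l → g j (b l) = 0) (hdiag : ∀ j, g j (b j) ≠ 0) :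
    LinearIndependent L g := by
  let T : Matrix (Fin n) (Fin n) L := .of fun j l => g j (b l)
  have hT : T.IsLowerTriangular := fun j l h => hlt j l h
  refine LinearIndependent.of_comp (LinearMap.pi fun l => LinearMap.applyₗ' L (b l))
    (T.linearIndependent_rows_of_det_ne_zero ?_)
  rw [T.det_of_isLowerTriangular hT]
  exact Finset.prod_ne_zero_iff.2 fun j _ => hdiag j

theorem finrank_range_le_of_forall_basis (b : Basis (Fin n) F V) {f : V →ₗ[F] L} {w : ℕ}
    (hf : ∀ l : Fin n, w ≤ l → f (b l) = 0) : finrank F (LinearMap.range f) ≤ w := by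
  have : FiniteDimensional F V := b.finiteDimensional_of_finite
  have hle : Submodule.span F (b '' {l | (l : ℕ) < w}ᶜ) ≤ LinearMap.ker f := by
    rw [Submodule.span_le]
    rintro _ ⟨l, hl, rfl⟩
    exact hf l (not_lt.1 hl)
  have hker := Submodule.finrank_mono hle
  rw [finrank_span_image b.linearIndependent, Set.ncard_compl, Nat.card_fin,
    ncard_setOf_val_lt] at hker
  have hrange := f.finrank_range_add_finrank_ker
  rw [finrank_eq_card_basis b, Fintype.card_fin] at hrange
  omega

theorem exists_mem_gabidulin_forall_basis_apply_eq_zero_iff [Fintype F] {α : V →ₗ[F] L}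
    (hα : Function.Injective α) (b : Basis (Fin n) F V) (j : Fin n) :
    ∃ g ∈ gabidulin α (n - j), ∀ l, g (b l) = 0 ↔ j < l := by
  have : FiniteDimensional F V := b.finiteDimensional_of_finite
  obtain ⟨g, hg, hker⟩ := exists_mem_gabidulin_ker_eq hα (Submodule.span F (b '' Set.Ioi j))
  rw [finrank_span_image b.linearIndependent, Set.ncard_eq_toFinset_card', Set.toFinset_Ioi,
    Fin.card_Ioi] at hg
  refine ⟨g, gabidulin_mono α (by omega) hg, fun l => ?_⟩
  rw [← LinearMap.mem_ker, hker, b.self_mem_span_image, Set.mem_Ioi]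

variable [Finite F]

/-- The witnesses are the maps `β t • g j`, where `g j` is an element of the Gabidulin code with
`n - j` coefficients that kills exactly the last `n - j - 1` vectors of `b`. -/
theorem exists_linearIndependent_graded (b : Basis (Fin n) F V) {m : ℕ}
    (β : Basis (Fin m) F L) (hnm : n ≤ m) :
    ∃ x : Fin m × Fin n → V →ₗ[F] L, LinearIndependent F x ∧
      (∀ w : ℕ, IsAnticode (Submodule.span F (x '' {p | p.2 < w})) w) ∧
      ∀ w : ℕ, ∀ f ∈ Submodule.span F (x '' {p | w ≤ p.2}), f ≠ 0 →
        w < finrank F (LinearMap.range f) := by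
  have := Fintype.ofFinite F
  have : FiniteDimensional F V := b.finiteDimensional_of_finite
  have : FiniteDimensional F L := β.finiteDimensional_of_finite
  obtain ⟨α, hα⟩ : ∃ α : V →ₗ[F] L, Function.Injective α := by
    rw [← finrank_le_iff_exists_linearMap, finrank_eq_card_basis b, finrank_eq_card_basis β]
    simpa using hnm
  choose g hg hgb using exists_mem_gabidulin_forall_basis_apply_eq_zero_iff hα b
  have hind : LinearIndependent L g := linearIndependent_of_triangular b
    (fun j l => (hgb j l).2) fun j h => lt_irrefl j ((hgb j j).1 h)
  refine ⟨_, linearIndependent_smul β.linearIndependent hind, fun w f hf => ?_,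
    fun w f hf h0 => ?_⟩
  · refine finrank_range_le_of_forall_basis b fun l hl => ?_
    suffices h : Submodule.span F _ ≤ LinearMap.ker (LinearMap.applyₗ (b l)) from h hf
    rw [Submodule.span_le]
    rintro _ ⟨p, hp, rfl⟩
    have hpl : g p.2 (b l) = 0 := (hgb p.2 l).2 (Fin.lt_def.2 (hp.trans_le hl))
    exact LinearMap.mem_ker.2 ((congrArg (β p.1 • ·) hpl).trans (smul_zero _))
  · suffices h : Submodule.span F _ ≤ (gabidulin α (n - w)).restrictScalars F by
      have hker := finrank_ker_lt_of_mem_gabidulin hα (h hf) h0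
      have hrange := f.finrank_range_add_finrank_ker
      rw [finrank_eq_card_basis b, Fintype.card_fin] at hrange
      omega
    rw [Submodule.span_le]
    rintro _ ⟨p, hp, rfl⟩
    exact Submodule.smul_mem _ _ (gabidulin_mono α (Nat.sub_le_sub_left hp n) (hg p.2))

end GradedBasis

section Sequence

variable {k m n : ℕ} {d : Fin k → ℕ}

theorem forall_constant_card_le_iff (hd : Monotone d) :
    (∀ S : Finset (Fin k), (∀ i ∈ S, ∀ j ∈ S, d i = d j) → S.card ≤ m) ↔
      ∀ i j : Fin k, (i : ℕ) + m ≤ j → d i < d j := by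
  constructor
  · intro h i j hij
    refine (hd (Fin.le_def.2 (by omega))).lt_of_ne fun heq => ?_
    have hconst : ∀ l ∈ Finset.Icc i j, d l = d i := fun l hl =>
      le_antisymm ((hd (Finset.mem_Icc.1 hl).2).trans_eq heq.symm) (hd (Finset.mem_Icc.1 hl).1)
    have hcard := h (Finset.Icc i j) fun l hl l' hl' => (hconst l hl).trans (hconst l' hl').symm
    rw [Fin.card_Icc] at hcard
    omega
  · intro h S hS
    obtain rfl | hne := S.eq_empty_or_nonempty
    · exact Nat.zero_le m
    have hsub : S ⊆ Finset.Icc (S.min' hne) (S.max' hne) := fun l hl =>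
      Finset.mem_Icc.2 ⟨S.min'_le l hl, S.le_max' l hl⟩
    have hcard := Finset.card_le_card hsub
    rw [Fin.card_Icc] at hcard
    have heq := hS _ (S.min'_mem hne) _ (S.max'_mem hne)
    by_contra! hm
    exact (h _ _ (by omega)).ne heq

theorem exists_injective_snd_add_one_eq (hm : 0 < m) (hpos : ∀ i, 0 < d i) (hdn : ∀ i, d i ≤ n)
    (hgap : ∀ i j : Fin k, (i : ℕ) + m ≤ j → d i < d j) :
    ∃ ι : Fin k → Fin m × Fin n, Function.Injective ι ∧ ∀ i, (ι i).2 + 1 = d i := by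
  have hpred (i) : d i - 1 + 1 = d i := Nat.sub_add_cancel (hpos i)
  refine ⟨fun i => (⟨i % m, Nat.mod_lt _ hm⟩, ⟨d i - 1, ?_⟩), ?_, hpred⟩
  · exact (Nat.sub_one_lt (hpos i).ne').trans_le (hdn i)
  suffices h : ∀ i j : Fin k, i < j → (i : ℕ) % m = j % m → d i ≠ d j by
    intro i j hij
    simp only [Prod.mk.injEq, Fin.mk.injEq] at hij
    have hd : d i = d j := by rw [← hpred i, hij.2, hpred j]
    by_contra hne
    obtain hlt | hlt := lt_or_gt_of_ne hne
    · exact h i j hlt hij.1 hd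
    · exact h j i hlt hij.1.symm hd.symm
  intro i j hij hmod
  exact (hgap i j (Nat.ModEq.add_le_of_lt hmod hij)).ne

end Sequence

section Construction

variable {F : Type*} [Field F] [Finite F] {m n : ℕ}

theorem exists_linearIndependent_graded_code (hm : 0 < m) (hnm : n ≤ m) :
    ∃ x : Fin m × Fin n → Matrix (Fin m) (Fin n) F, LinearIndependent F x ∧
      (∀ w : ℕ, maxRank (Submodule.span F (x '' {p | p.2 < w})) ≤ w) ∧
      ∀ w : ℕ, ∀ M ∈ Submodule.span F (x '' {p | w ≤ p.2}), M ≠ 0 → w < M.rank := by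
  obtain ⟨L, _, _, _, hL⟩ := exists_extension_finrank_eq F hm
  let β := finBasisOfFinrankEq F L hL
  obtain ⟨x, hx, hle, hlt⟩ := exists_linearIndependent_graded (Pi.basisFun F (Fin n)) β hnm
  let Φ : ((Fin n → F) →ₗ[F] L) ≃ₗ[F] Matrix (Fin m) (Fin n) F :=
    LinearEquiv.congrRight β.equivFun ≪≫ₗ LinearMap.toMatrix'
  have rank_Φ (f) : (Φ f).rank = finrank F (LinearMap.range f) := by
    change finrank F
      (LinearMap.range (LinearMap.toMatrix' (β.equivFun.toLinearMap ∘ₗ f)).toLin') = _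
    rw [Matrix.toLin'_toMatrix', LinearMap.range_comp, LinearEquiv.finrank_map_eq]
  have mem_span {M} {s : Set (Fin m × Fin n)} (hM : M ∈ Submodule.span F (Φ ∘ x '' s)) :
      ∃ f ∈ Submodule.span F (x '' s), Φ f = M := by
    rwa [Set.image_comp, ← LinearEquiv.coe_coe, ← Submodule.map_span] at hM
  refine ⟨Φ ∘ x, hx.map' Φ.toLinearMap Φ.ker, fun w => maxRank_le_iff.2 fun M hM => ?_,
    fun w M hM h0 => ?_⟩
  · obtain ⟨f, hf, rfl⟩ := mem_span hM
    exact (rank_Φ f).trans_le (hle w f hf)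
  · obtain ⟨f, hf, rfl⟩ := mem_span hM
    exact (hlt w f hf fun h => h0 (by rw [h, map_zero])).trans_eq (rank_Φ f).symm

variable {k : ℕ} {d : Fin k → ℕ}

theorem exists_isGenWeightSequence (hm : 0 < m) (hnm : n ≤ m) (hmono : Monotone d)
    (hpos : ∀ i, 0 < d i) (hdn : ∀ i, d i ≤ n)
    (hgap : ∀ i j : Fin k, (i : ℕ) + m ≤ j → d i < d j) :
    ∃ C : Submodule F (Matrix (Fin m) (Fin n) F), IsGenWeightSequence C d := by
  obtain ⟨x, hx, hle, hlt⟩ := exists_linearIndependent_graded_code (F := F) hm hnm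
  obtain ⟨ι, hι, hιd⟩ := exists_injective_snd_add_one_eq hm hpos hdn hgap
  have hy : LinearIndependent F (x ∘ ι) := hx.comp ι hι
  have span_le {s : Set (Fin k)} {t : Set (Fin m × Fin n)} (h : ∀ i ∈ s, ι i ∈ t) :
      Submodule.span F (x ∘ ι '' s) ≤ Submodule.span F (x '' t) := by
    rw [Set.image_comp]
    exact Submodule.span_mono (Set.image_mono (Set.image_subset_iff.2 h))
  set C := Submodule.span F (x ∘ ι '' Set.univ) with hC
  have hdim : finrank F C = k := by
    rw [hC, finrank_span_image hy, Set.ncard_univ, Nat.card_fin]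
  refine ⟨C, hdim, fun i => le_antisymm ?_ ?_⟩
  · have hA : finrank F (Submodule.span F (x '' {p | p.2 < d i})) = m * d i := by
      rw [finrank_span_image hx, ncard_setOf_snd_lt, min_eq_right (hdn i)]
    refine genWeight_le_of_le hnm hm (D := Submodule.span F (x ∘ ι '' Set.Iic i))
      (Submodule.span_mono (Set.image_mono (Set.subset_univ _))) ?_ (span_le fun l hl => ?_)
      (hle (d i)) hA.ge
    · rw [finrank_span_image hy, Set.ncard_eq_toFinset_card', Set.toFinset_Iic, Fin.card_Iic]
    · exact Nat.lt_of_succ_le ((hιd l).trans_le (hmono hl))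
  · refine le_genWeight_of_le_rank hnm (G := Submodule.span F (x ∘ ι '' Set.Ici i))
      (Submodule.span_mono (Set.image_mono (Set.subset_univ _))) (fun M hM h0 => ?_) (by omega) ?_
    · have hMx := span_le (t := {p | d i - 1 ≤ p.2}) (fun l hl => ?_) hM
      · exact Nat.le_of_pred_lt (hlt _ M hMx h0)
      · exact Nat.sub_le_of_le_add ((hmono hl).trans_eq (hιd l).symm)
    · rw [hdim, finrank_span_image hy, Set.ncard_eq_toFinset_card', Set.toFinset_Ici, Fin.card_Ici]
      omega

end Construction

end RankMetric

theorem theorem4p8 {F : Type*} [Field F] [Finite F] (m n : ℕ) (hn : 1 ≤ n) (hnm : n ≤ m)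
    (k : ℕ) (d : Fin k → ℕ) (hmono : Monotone d) (hpos : ∀ i, 0 < d i) :
    (∃ C : Submodule F (Matrix (Fin m) (Fin n) F), RankMetric.IsGenWeightSequence C d) ↔
      k ≤ m * n ∧
      (∀ hk : 0 < k, d ⟨k - 1, Nat.sub_lt hk Nat.one_pos⟩ ≤ n) ∧
      (∀ S : Finset (Fin k), (∀ i ∈ S, ∀ j ∈ S, d i = d j) → S.card ≤ m) := by
  have hm : 0 < m := hn.trans hnm
  rw [RankMetric.forall_constant_card_le_iff hmono]
  constructor
  · rintro ⟨C, hdim, hd⟩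
    refine ⟨?_, fun hk => ?_, fun i j hij => ?_⟩
    · have hle := C.finrank_le
      rwa [hdim, finrank_matrix, finrank_self, mul_one, Fintype.card_fin, Fintype.card_fin] at hle
    · rw [← hd]
      exact RankMetric.genWeight_le hnm C (by omega)
    · rw [← hd, ← hd]
      exact RankMetric.genWeight_lt_genWeight hnm C hm (by omega) (by omega)
  · rintro ⟨-, hlast, hgap⟩
    refine RankMetric.exists_isGenWeightSequence hm hnm hmono hpos (fun i => ?_) hgap
    exact (hmono (Fin.le_def.2 (Nat.le_sub_one_of_lt i.2))).trans (hlast i.pos)
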